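/- All C*-algebras and *-homomorphisms are unital. Call $S_1,S_2$ in a C*-algebra a Cuntz pair if $S_1^*S_1=S_2^*S_2=1$ and $S_1S_1^*+S_2S_2^*=1$, and let $C^*(S_1,S_2)$ be the C*-algebra they generate. The Cuntz algebra $\mathcal{O}_2$ is the universal C*-algebra generated by a Cuntz pair. For a *-automorphism $\sigma$ of a C*-algebra $O$, let $O\rtimes_\sigma\mathbb{Z}$ be the universal C*-algebra generated by a copy of $O$ and a unitary $U$ with $UaU^*=\sigma(a)$ for all $a\in O$. If $\sigma^2=\mathrm{id}$, let $O\rtimes_\sigma\mathbb{Z}_2$ be the universal C*-algebra generated by a copy of $O$ and a unitary $w$ with $w^2=1$ and $waw^*=\sigma(a)$ for all $a\in O$. **Theorem.** (1) There is a unique *-automorphism $\sigma$ of $\mathcal{O}_2=C^*(S_1,S_2)$ with $\sigma(S_1)=S_2$ and $\sigma(S_2)=S_1$. There is a unique *-automorphism $\widehat{\sigma}$ of $\mathcal{O}_2\rtimes_\sigma\mathbb{Z}_2$ with $\widehat\sigma(a)=a$ for all $a\in\mathcal{O}_2$ and $\widehat\sigma(w)=-w$, and $\mathcal{O}_2\rtimes_\sigma\mathbb{Z}$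 is *-isomorphic to $$\left\{f\in C\big([-1,1],\ \mathcal{O}_2\rtimes_\sigma\mathbb{Z}_2\big) : f(-1)=\widehat{\sigma}(f(1))\right\}.$$ (2) More generally, let $S_1,S_2$ be any Cuntz pair in any C*-algebra, let $O=C^*(S_1,S_2)$, and let $\sigma$ be the *-automorphism of $O$ with $\sigma(S_1)=S_2$ and $\sigma(S_2)=S_1$. Then the conclusions of (1) about $\widehat\sigma$ and about $O\rtimes_\sigma\mathbb{Z}$ hold with $O$ in place of $\mathcal{O}_2$. -/

import Mathlib

open scoped ENNReal

/-! ## The `ℓ^∞`-direct sum of a family of unital C*-algebras -/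

noncomputable instance lpInftyCStarAlgebra {I : Type*} {A : I → Type*}
    [∀ i, Nontrivial (A i)] [∀ i, CStarAlgebra (A i)] : CStarAlgebra (lp A ∞) where

/-- A family of unital `*`-homomorphisms `O → A i`, assembled into one unital `*`-homomorphism
from `O` into the `ℓ^∞`-direct sum of the `A i`. -/
noncomputable def starAlgHomToLp {I : Type*} {A : I → Type*}
    [∀ i, Nontrivial (A i)] [∀ i, CStarAlgebra (A i)] {O : Type*} [CStarAlgebra O]
    (π : ∀ i, O →⋆ₐ[ℂ] A i) : O →⋆ₐ[ℂ] lp A ∞ where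
  toFun a := ⟨fun i => π i a, memℓp_infty ⟨‖a‖, by
    rintro _ ⟨i, rfl⟩
    exact NonUnitalStarAlgHom.norm_apply_le (π i) a⟩⟩
  map_one' := by ext i; simp
  map_mul' a b := by ext i; simp
  map_zero' := by ext i; simp
  map_add' a b := by
    ext i
    exact map_add (π i) a b
  commutes' c := by
    ext i
    exact AlgHomClass.commutes (π i) c
  map_star' a := by
    ext i
    exact map_star (π i) a

/-! ## Generated C*-subalgebras and Cuntz pairs -/

/-- `C*(s)`: the closed unital `*`-subalgebra of the unital C*-algebra `A` generated by `s`. -/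
noncomputable def cstarGenerated {A : Type*} [CStarAlgebra A] (s : Set A) : StarSubalgebra ℂ A :=
  (StarAlgebra.adjoin ℂ s).topologicalClosure

theorem mem_cstarGenerated {A : Type*} [CStarAlgebra A] {s : Set A} {x : A} (hx : x ∈ s) :
    x ∈ cstarGenerated s :=
  StarSubalgebra.le_topologicalClosure _ (StarAlgebra.subset_adjoin ℂ s hx)

noncomputable instance cstarGeneratedCStarAlgebra {A : Type*} [CStarAlgebra A] (s : Set A) :
    CStarAlgebra (cstarGenerated s) :=
  StarSubalgebra.cstarAlgebra _
    (h_closed := StarSubalgebra.isClosed_topologicalClosure (StarAlgebra.adjoin ℂ s))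

/-- `S₁` and `S₂` are isometries satisfying the Cuntz relation `S₁ S₁* + S₂ S₂* = 1`. -/
structure IsCuntzPair {A : Type*} [CStarAlgebra A] (S₁ S₂ : A) : Prop where
  isometry_left : star S₁ * S₁ = 1
  isometry_right : star S₂ * S₂ = 1
  cuntz_relation : S₁ * star S₁ + S₂ * star S₂ = 1

/-- The first generator of `C*(S₁, S₂)`. -/
noncomputable def firstGen {A : Type*} [CStarAlgebra A] (S₁ S₂ : A) :
    cstarGenerated ({S₁, S₂} : Set A) :=
  ⟨S₁, mem_cstarGenerated (by simp)⟩

/-- The second generator of `C*(S₁, S₂)`. -/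
noncomputable def secondGen {A : Type*} [CStarAlgebra A] (S₁ S₂ : A) :
    cstarGenerated ({S₁, S₂} : Set A) :=
  ⟨S₂, mem_cstarGenerated (by simp)⟩

/-! ## The Cuntz algebra `𝒪₂`

The universal C*-algebra generated by a Cuntz pair: the C*-algebra generated by the direct sum of
all Cuntz pairs. It suffices to take pairs in C*-algebras living in `Type`, since
C*-algebras generated by two elements are separable, hence have at most continuum many points. -/

/-- A Cuntz pair in a nonzero unital C*-algebra. -/
structure CuntzRep where
  alg : Type
  [cstar : CStarAlgebra alg]
  [nontriv : Nontrivial alg]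
  S₁ : alg
  S₂ : alg
  isCuntzPair : IsCuntzPair S₁ S₂

attribute [instance] CuntzRep.cstar CuntzRep.nontriv

theorem norm_le_one_of_isometry {A : Type*} [CStarAlgebra A] [Nontrivial A] {S : A}
    (h : star S * S = 1) : ‖S‖ ≤ 1 := by
  have h1 : ‖S‖ * ‖S‖ = 1 := by rw [← CStarRing.norm_star_mul_self, h, CStarRing.norm_one]
  nlinarith [norm_nonneg S]

/-- The first universal isometry, acting as `S₁` in every Cuntz pair. -/
noncomputable def univS₁ : lp (fun ρ : CuntzRep => ρ.alg) ∞ :=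
  ⟨fun ρ => ρ.S₁, memℓp_infty ⟨1, by
    rintro _ ⟨ρ, rfl⟩
    exact norm_le_one_of_isometry ρ.isCuntzPair.isometry_left⟩⟩

/-- The second universal isometry, acting as `S₂` in every Cuntz pair. -/
noncomputable def univS₂ : lp (fun ρ : CuntzRep => ρ.alg) ∞ :=
  ⟨fun ρ => ρ.S₂, memℓp_infty ⟨1, by
    rintro _ ⟨ρ, rfl⟩
    exact norm_le_one_of_isometry ρ.isCuntzPair.isometry_right⟩⟩

theorem isCuntzPair_univ : IsCuntzPair univS₁ univS₂ where
  isometry_left := by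
    ext ρ
    exact ρ.isCuntzPair.isometry_left
  isometry_right := by
    ext ρ
    exact ρ.isCuntzPair.isometry_right
  cuntz_relation := by
    ext ρ
    exact ρ.isCuntzPair.cuntz_relation

/-- The Cuntz algebra `𝒪₂ = C*(S₁, S₂)`, for the universal Cuntz pair. -/
abbrev CuntzO₂ : Type 1 := cstarGenerated {univS₁, univS₂}

/-- `σ` is the automorphism of `C*(S₁, S₂)` that exchanges `S₁` and `S₂`. -/
def IsSwap {A : Type*} [CStarAlgebra A] (S₁ S₂ : A)
    (σ : cstarGenerated {S₁, S₂} ≃⋆ₐ[ℂ] cstarGenerated {S₁, S₂}) : Prop :=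
  σ (firstGen S₁ S₂) = secondGen S₁ S₂ ∧ σ (secondGen S₁ S₂) = firstGen S₁ S₂

/-! ## Crossed products by a cyclic group

For a `*`-automorphism `σ` of a unital C*-algebra `O` with `σ ^ n = 1`, the crossed product of `O`
by the action of the cyclic group `ℤ/n` (with `ℤ/0 = ℤ`) generated by `σ` is the universal
C*-algebra generated by a copy of `O` and a unitary `u` with `u a u* = σ(a)` for `a ∈ O` and
`u ^ n = 1`. It is the C*-algebra generated by the direct sum of all covariant representations.
It suffices to take representations in the universe of `O`, since the C*-algebra generated
by an image of `O` and one more element always has an isomorphic copy in that universe. -/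

/-- A covariant representation, in a nonzero unital C*-algebra, of the action of `ℤ/n` on `O`
generated by `σ`. -/
structure CovariantRep.{u} {O : Type u} [CStarAlgebra O] (σ : O ≃⋆ₐ[ℂ] O) (n : ℕ) where
  alg : Type u
  [cstar : CStarAlgebra alg]
  [nontriv : Nontrivial alg]
  π : O →⋆ₐ[ℂ] alg
  U : alg
  star_mul_self : star U * U = 1
  mul_star_self : U * star U = 1
  covariant : ∀ a, U * π a * star U = π (σ a)
  pow_eq_one : U ^ n = 1

attribute [instance] CovariantRep.cstar CovariantRep.nontriv

section CrossedProduct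

universe u

variable {O : Type u} [CStarAlgebra O] (σ : O ≃⋆ₐ[ℂ] O) (n : ℕ)

/-- The direct sum of all covariant representations, on `O`. -/
noncomputable def univCoeff : O →⋆ₐ[ℂ] lp (fun ρ : CovariantRep σ n => ρ.alg) ∞ :=
  starAlgHomToLp fun ρ => ρ.π

/-- The direct sum of all covariant representations, on the generator of the group. -/
noncomputable def univUnitary : lp (fun ρ : CovariantRep σ n => ρ.alg) ∞ :=
  ⟨fun ρ => ρ.U, memℓp_infty ⟨1, by
    rintro _ ⟨ρ, rfl⟩
    exact norm_le_one_of_isometry ρ.star_mul_self⟩⟩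

/-- The (full) crossed product of `O` by the action of `ℤ/n` generated by `σ`. -/
abbrev CyclicCrossedProduct : Type (u + 1) :=
  cstarGenerated (Set.range (univCoeff σ n) ∪ {univUnitary σ n})

/-- The crossed product `O ⋊_σ ℤ`. -/
abbrev CrossedProductZ : Type (u + 1) := CyclicCrossedProduct σ 0

/-- The crossed product `O ⋊_σ ℤ₂` (for `σ` with `σ² = 1`). -/
abbrev CrossedProductZ₂ : Type (u + 1) := CyclicCrossedProduct σ 2

/-- The canonical copy in the crossed product of an element of `O`. -/
noncomputable def crossedCoeff (a : O) : CyclicCrossedProduct σ n :=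
  ⟨univCoeff σ n a, mem_cstarGenerated (Or.inl ⟨a, rfl⟩)⟩

/-- The canonical unitary of the crossed product. -/
noncomputable def crossedUnitary : CyclicCrossedProduct σ n :=
  ⟨univUnitary σ n, mem_cstarGenerated (Or.inr rfl)⟩

/-- `α` is the dual automorphism of `O ⋊_σ ℤ₂`: it fixes `O` and sends the canonical unitary `w`
to `-w`. -/
def IsDualAutomorphism (α : CrossedProductZ₂ σ ≃⋆ₐ[ℂ] CrossedProductZ₂ σ) : Prop :=
  (∀ a : O, α (crossedCoeff σ 2 a) = crossedCoeff σ 2 a) ∧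
    α (crossedUnitary σ 2) = -crossedUnitary σ 2

end CrossedProduct

/-! ## Twisted function algebras -/

/-- The `*`-algebra `{f ∈ C([-1,1], B) : f(-1) = α(f(1))}`. -/
def twistedFunctions {B : Type*} [CStarAlgebra B] (α : B ≃⋆ₐ[ℂ] B) :
    StarSubalgebra ℂ C(Set.Icc (-1 : ℝ) 1, B) where
  carrier := {f | f ⟨-1, by norm_num⟩ = α (f ⟨1, by norm_num⟩)}
  mul_mem' {f g} hf hg := by
    simp only [Set.mem_ofPred_eq, ContinuousMap.mul_apply, map_mul] at *
    rw [hf, hg]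
  add_mem' {f g} hf hg := by
    simp only [Set.mem_ofPred_eq, ContinuousMap.add_apply, map_add] at *
    rw [hf, hg]
  algebraMap_mem' c := by
    exact (AlgHomClass.commutes α c).symm
  star_mem' {f} hf := by
    simp only [Set.mem_ofPred_eq, ContinuousMap.star_apply, map_star] at *
    rw [hf]

/-! The swap is an involution because it is one on generators, and the rest holds for every
automorphism with `σ² = id`. Send `a` to the constant function `a` and `U` to `t ↦ exp(iπt/2) w`.
The values of the latter at `t = ±1` are `±i w`, which the dual automorphism exchanges, so the image
consists of twisted functions (`mappingTorusHom_mem`).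

Injectivity: if `x` is killed, then `σhat` carries this from the half circle to all `z` in the
circle: each homomorphism `a ↦ a, U ↦ z w` kills `x`. So `U ↦ w` kills the whole gauge orbit of `x`.
The Fourier coefficients of that orbit have the form `a_n U^n`, and `O` embeds in `O ⋊ ℤ₂`, so all
`a_n` vanish. Hence the orbit is zero, and so is `x` (`eq_zero_of_gauge_orbit_eq_zero`).

Surjectivity: the image is closed, is dense at every point `t`, and contains the image `exp(iπt)` of
`U²`, hence all scalar functions on the circle. A partition of unity concludes
(`twistedFunctions_le_of_dense`).

The universal algebras sit inside direct sums over representations, so the maps between them are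
induced by maps of index sets, in the opposite direction. -/

open scoped CStarAlgebra

/-! ### Homomorphisms on generated C*-algebras -/

section Generated

variable {A B : Type*} [CStarAlgebra A] [CStarAlgebra B]

/-- The closure defining `C*(s)` is taken in `A`; the subspace topology turns it into density inside
`C*(s)` itself, so that homomorphisms are determined on generators. -/
theorem topologicalClosure_adjoin_preimage_cstarGenerated (s : Set A) :
    (StarAlgebra.adjoin ℂ (Subtype.val ⁻¹' s : Set (cstarGenerated s))).topologicalClosure = ⊤ := by
  have hmap : (StarAlgebra.adjoin ℂ (Subtype.val ⁻¹' s : Set (cstarGenerated s))).map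
      (cstarGenerated s).subtype = StarAlgebra.adjoin ℂ s := by
    rw [StarAlgHom.map_adjoin]
    congr 1
    ext x
    constructor
    · rintro ⟨y, hy, rfl⟩
      exact hy
    · exact fun hx => ⟨⟨x, mem_cstarGenerated hx⟩, hx, rfl⟩
  rw [eq_top_iff]
  intro x _
  rw [← SetLike.mem_coe, StarSubalgebra.topologicalClosure_coe,
    Topology.IsInducing.subtypeVal.closure_eq_preimage_closure_image]
  have hx : (x : A) ∈ closure ((StarAlgebra.adjoin ℂ s : StarSubalgebra ℂ A) : Set A) := x.2
  rw [← hmap] at hx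
  exact hx

/-- A `*`-homomorphism carrying generators into `C*(t)` restricts to `C*(s) → C*(t)`. -/
noncomputable def cstarGeneratedMap {s : Set A} {t : Set B} (φ : A →⋆ₐ[ℂ] B)
    (h : ∀ x ∈ s, φ x ∈ cstarGenerated t) : cstarGenerated s →⋆ₐ[ℂ] cstarGenerated t :=
  (φ.comp (cstarGenerated s).subtype).codRestrict (cstarGenerated t) fun x => by
    have hle : cstarGenerated s ≤ (cstarGenerated t).comap φ := by
      refine StarSubalgebra.topologicalClosure_minimal (StarAlgebra.adjoin_le h) ?_
      exact (StarSubalgebra.isClosed_topologicalClosure _).preimage (map_continuous φ)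
    exact hle x.2

theorem starAlgHom_eq_of_eqOn_of_dense {s : Set A}
    (hs : (StarAlgebra.adjoin ℂ s).topologicalClosure = ⊤) {φ ψ : A →⋆ₐ[ℂ] B}
    (h : ∀ x ∈ s, φ x = ψ x) : φ = ψ := by
  have hle : (StarAlgebra.adjoin ℂ s).topologicalClosure ≤ StarAlgHom.equalizer φ ψ :=
    StarSubalgebra.topologicalClosure_minimal (StarAlgHom.adjoin_le_equalizer φ ψ h)
      (isClosed_eq (map_continuous φ) (map_continuous ψ))
  ext x
  exact hle (hs ▸ StarSubalgebra.mem_top)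

theorem cstarGenerated_hom_ext {s : Set A} {φ ψ : cstarGenerated s →⋆ₐ[ℂ] B}
    (h : ∀ (x : A) (hx : x ∈ s),
      φ ⟨x, mem_cstarGenerated hx⟩ = ψ ⟨x, mem_cstarGenerated hx⟩) : φ = ψ :=
  starAlgHom_eq_of_eqOn_of_dense (topologicalClosure_adjoin_preimage_cstarGenerated s)
    fun x hx => h x.1 hx

end Generated

/-! ### Maps of direct sums from maps of index sets -/

section Reindex

/-- The `*`-homomorphism between `ℓ^∞`-direct sums induced by a map of the index sets. -/
noncomputable def lpReindex {I J : Type*} {A : I → Type*} [∀ i, Nontrivial (A i)]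
    [∀ i, CStarAlgebra (A i)] (f : J → I) : lp A ∞ →⋆ₐ[ℂ] lp (fun j => A (f j)) ∞ :=
  starAlgHomToLp fun j =>
    { toFun := fun x => x.1 (f j)
      map_one' := rfl
      map_mul' := fun _ _ => rfl
      map_zero' := rfl
      map_add' := fun _ _ => rfl
      commutes' := fun _ => rfl
      map_star' := fun _ => rfl }

end Reindex

/-! ### The swap automorphism -/

section Swap

/-- Exchanging the two isometries of a Cuntz pair. -/
def CuntzRep.swap (ρ : CuntzRep) : CuntzRep where
  alg := ρ.alg
  S₁ := ρ.S₂
  S₂ := ρ.S₁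
  isCuntzPair :=
    ⟨ρ.isCuntzPair.isometry_right, ρ.isCuntzPair.isometry_left,
      (add_comm _ _).trans ρ.isCuntzPair.cuntz_relation⟩

/-- The endomorphism of the direct sum of all Cuntz pairs exchanging the isometries. -/
noncomputable def univSwap :
    lp (fun ρ : CuntzRep => ρ.alg) ∞ →⋆ₐ[ℂ] lp (fun ρ : CuntzRep => ρ.alg) ∞ :=
  lpReindex CuntzRep.swap

/-- The endomorphism of `𝒪₂` exchanging the generators. -/
noncomputable def cuntzSwapHom : CuntzO₂ →⋆ₐ[ℂ] CuntzO₂ :=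
  cstarGeneratedMap univSwap fun x hx => by
    rcases hx with rfl | rfl
    · exact mem_cstarGenerated (Or.inr rfl)
    · exact mem_cstarGenerated (Or.inl rfl)

/-- Exchanging the isometries permutes the index set of all Cuntz pairs and is its own inverse
there. -/
theorem exists_isSwap_cuntzO₂ : ∃ σ : CuntzO₂ ≃⋆ₐ[ℂ] CuntzO₂, IsSwap univS₁ univS₂ σ :=
  ⟨StarAlgEquiv.ofStarAlgHom cuntzSwapHom cuntzSwapHom
    (by ext x; rfl) (by ext x; rfl),
    rfl, rfl⟩

variable {A : Type*} [CStarAlgebra A] {S₁ S₂ : A}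

theorem IsSwap.unique {σ τ : cstarGenerated {S₁, S₂} ≃⋆ₐ[ℂ] cstarGenerated {S₁, S₂}}
    (hσ : IsSwap S₁ S₂ σ) (hτ : IsSwap S₁ S₂ τ) : σ = τ := by
  have h : (σ : cstarGenerated {S₁, S₂} →⋆ₐ[ℂ] cstarGenerated {S₁, S₂}) = τ := by
    refine cstarGenerated_hom_ext ?_
    rintro x (rfl | rfl)
    · exact hσ.1.trans hτ.1.symm
    · exact hσ.2.trans hτ.2.symm
  ext1 x
  exact DFunLike.congr_fun h x

theorem IsSwap.apply_apply {σ : cstarGenerated {S₁, S₂} ≃⋆ₐ[ℂ] cstarGenerated {S₁, S₂}}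
    (hσ : IsSwap S₁ S₂ σ) (x : cstarGenerated {S₁, S₂}) : σ (σ x) = x := by
  have h : (σ : cstarGenerated {S₁, S₂} →⋆ₐ[ℂ] cstarGenerated {S₁, S₂}).comp σ =
      StarAlgHom.id ℂ _ := by
    refine cstarGenerated_hom_ext ?_
    rintro x (rfl | rfl)
    · exact (congrArg σ hσ.1).trans hσ.2
    · exact (congrArg σ hσ.2).trans hσ.1
  exact DFunLike.congr_fun h x

end Swap

/-! ### Twists of crossed products and the dual automorphism -/

section CrossedHom

universe u

variable {O : Type u} [CStarAlgebra O] {σ : O ≃⋆ₐ[ℂ] O}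

/-- Multiplying the unitary of a covariant representation by a scalar of modulus one. -/
noncomputable def CovariantRep.twist {m : ℕ} (ρ : CovariantRep σ m) (n : ℕ) (hmn : m ∣ n)
    (z : Circle) (hz : z ^ n = 1) : CovariantRep σ n where
  alg := ρ.alg
  π := ρ.π
  U := (z : ℂ) • ρ.U
  star_mul_self := by
    rw [star_smul, smul_mul_smul_comm, ρ.star_mul_self, Complex.star_def, ← Circle.coe_inv_eq_conj,
      ← Circle.coe_mul, inv_mul_cancel, Circle.coe_one, one_smul]
  mul_star_self := by
    rw [star_smul, smul_mul_smul_comm, ρ.mul_star_self, Complex.star_def, ← Circle.coe_inv_eq_conj,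
      ← Circle.coe_mul, mul_inv_cancel, Circle.coe_one, one_smul]
  covariant a := by
    rw [star_smul, smul_mul_assoc, smul_mul_smul_comm, ρ.covariant, Complex.star_def,
      ← Circle.coe_inv_eq_conj, ← Circle.coe_mul, mul_inv_cancel, Circle.coe_one, one_smul]
  pow_eq_one := by
    -- `(zU)^n = z^n (U^m)^k` with `n = mk`; for `n = 0` every `z` is allowed.
    obtain ⟨k, rfl⟩ := hmn
    rw [smul_pow, pow_mul ρ.U, ρ.pow_eq_one, one_pow, ← Circle.coe_pow, hz, Circle.coe_one,
      one_smul]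

variable (σ) in
/-- The `*`-homomorphism `O ⋊ ℤ/n → O ⋊ ℤ/m` that fixes `O` and multiplies the unitary by `z`. -/
noncomputable def crossedTwist {m n : ℕ} (hmn : m ∣ n) (z : Circle) (hz : z ^ n = 1) :
    CyclicCrossedProduct σ n →⋆ₐ[ℂ] CyclicCrossedProduct σ m :=
  cstarGeneratedMap
    (lpReindex fun ρ : CovariantRep σ m => ρ.twist n hmn z hz :
      lp (fun ρ : CovariantRep σ n => ρ.alg) ∞ →⋆ₐ[ℂ] lp (fun ρ : CovariantRep σ m => ρ.alg) ∞) <| by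
    rintro _ (⟨a, rfl⟩ | rfl)
    · exact mem_cstarGenerated (Or.inl ⟨a, rfl⟩)
    · have hU : univUnitary σ m ∈ cstarGenerated (Set.range (univCoeff σ m) ∪ {univUnitary σ m}) :=
        mem_cstarGenerated (Or.inr rfl)
      exact SMulMemClass.smul_mem (z : ℂ) hU

@[simp]
theorem crossedTwist_crossedCoeff {m n : ℕ} (hmn : m ∣ n) (z : Circle) (hz : z ^ n = 1) (a : O) :
    crossedTwist σ hmn z hz (crossedCoeff σ n a) = crossedCoeff σ m a := rfl

@[simp]
theorem crossedTwist_crossedUnitary {m n : ℕ} (hmn : m ∣ n) (z : Circle) (hz : z ^ n = 1) :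
    crossedTwist σ hmn z hz (crossedUnitary σ n) = (z : ℂ) • crossedUnitary σ m := rfl

theorem crossedProduct_hom_ext {n : ℕ} {B : Type*} [CStarAlgebra B]
    {φ ψ : CyclicCrossedProduct σ n →⋆ₐ[ℂ] B}
    (hc : ∀ a, φ (crossedCoeff σ n a) = ψ (crossedCoeff σ n a))
    (hu : φ (crossedUnitary σ n) = ψ (crossedUnitary σ n)) : φ = ψ := by
  refine cstarGenerated_hom_ext ?_
  rintro _ (⟨a, rfl⟩ | rfl)
  · exact hc a
  · exact hu

variable (σ) in
/-- The canonical `*`-homomorphism from `O` to its crossed product. -/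
noncomputable def crossedCoeffHom (n : ℕ) : O →⋆ₐ[ℂ] CyclicCrossedProduct σ n :=
  (univCoeff σ n).codRestrict _ fun a => mem_cstarGenerated (Or.inl ⟨a, rfl⟩)

variable (σ) in
theorem crossedProduct_dense (n : ℕ) :
    (StarAlgebra.adjoin ℂ
      (Set.range (crossedCoeffHom σ n) ∪ {crossedUnitary σ n})).topologicalClosure = ⊤ := by
  rw [← topologicalClosure_adjoin_preimage_cstarGenerated
    (Set.range (univCoeff σ n) ∪ {univUnitary σ n})]
  congr 2
  ext x
  simp only [Set.mem_union, Set.mem_range, Set.mem_singleton_iff, Set.mem_preimage, Subtype.ext_iff]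
  rfl

theorem crossedUnitary_mem_unitary (n : ℕ) :
    crossedUnitary σ n ∈ unitary (CyclicCrossedProduct σ n) := by
  refine ⟨Subtype.ext ?_, Subtype.ext ?_⟩
  · ext ρ
    exact ρ.star_mul_self
  · ext ρ
    exact ρ.mul_star_self

theorem crossedUnitary_covariant (n : ℕ) (a : O) :
    crossedUnitary σ n * crossedCoeff σ n a * star (crossedUnitary σ n) =
      crossedCoeff σ n (σ a) := by
  apply Subtype.ext
  ext ρ
  exact ρ.covariant a

/-- The regular covariant representation of an involutive automorphism, by `2 × 2` matrices. -/
noncomputable def CovariantRep.regular [Nontrivial O] (h : ∀ a, σ (σ a) = a) :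
    CovariantRep σ 2 :=
  letI := CStarAlgebra.spectralOrder O
  letI := CStarAlgebra.spectralOrderedRing O
  { alg := CStarMatrix (Fin 2) (Fin 2) O
    nontriv := inferInstanceAs (Nontrivial (Matrix (Fin 2) (Fin 2) O))
    π :=
      { toFun := fun a => CStarMatrix.ofMatrix !![a, 0; 0, σ a]
        map_one' := by
          ext i j
          fin_cases i <;> fin_cases j <;> simp
        map_mul' := fun a b => by
          ext i j
          fin_cases i <;> fin_cases j <;> simp [CStarMatrix.mul_apply]
        map_zero' := by
          ext i j
          fin_cases i <;> fin_cases j <;> simp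
        map_add' := fun a b => by
          ext i j
          fin_cases i <;> fin_cases j <;> simp
        commutes' := fun c => by
          ext i j
          fin_cases i <;> fin_cases j <;> simp [CStarMatrix.algebraMap_apply, AlgHomClass.commutes]
        map_star' := fun a => by
          ext i j
          fin_cases i <;> fin_cases j <;> simp [CStarMatrix.star_apply, map_star] }
    U := CStarMatrix.ofMatrix !![0, 1; 1, 0]
    star_mul_self := by
      ext i j
      fin_cases i <;> fin_cases j <;> simp [CStarMatrix.mul_apply, CStarMatrix.star_apply]
    mul_star_self := by
      ext i j
      fin_cases i <;> fin_cases j <;> simp [CStarMatrix.mul_apply, CStarMatrix.star_apply]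
    covariant := fun a => by
      ext i j
      fin_cases i <;> fin_cases j <;> simp [CStarMatrix.mul_apply, CStarMatrix.star_apply, h]
    pow_eq_one := by
      ext i j
      fin_cases i <;> fin_cases j <;> simp [pow_two, CStarMatrix.mul_apply] }

/-- The regular representation is one of the summands, and its upper left entry returns `a`. The
zero algebra is treated apart, since representations are nonzero. -/
theorem crossedCoeffHom_two_injective (h : ∀ a, σ (σ a) = a) :
    Function.Injective (crossedCoeffHom σ 2) := by
  cases subsingleton_or_nontrivial O
  · exact Function.injective_of_subsingleton _
  intro a b hab
  have h1 : (CovariantRep.regular h).π a = (CovariantRep.regular h).π b :=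
    congrArg (fun x : CyclicCrossedProduct σ 2 => x.1 (CovariantRep.regular h)) hab
  exact congrArg (fun M : CStarMatrix (Fin 2) (Fin 2) O => M 0 0) h1

/-- The twist by `-1` is allowed because `(-1)² = 1`, and it is its own inverse. -/
theorem exists_isDualAutomorphism :
    ∃ α : CrossedProductZ₂ σ ≃⋆ₐ[ℂ] CrossedProductZ₂ σ, IsDualAutomorphism σ α := by
  have hz : ((-1 : Circle)) ^ 2 = 1 := by simp
  have hinv : (crossedTwist σ dvd_rfl (-1) hz).comp (crossedTwist σ dvd_rfl (-1) hz) =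
      StarAlgHom.id ℂ (CyclicCrossedProduct σ 2) := by
    refine crossedProduct_hom_ext (fun a => rfl) ?_
    simp
  exact ⟨StarAlgEquiv.ofStarAlgHom _ _ hinv hinv, fun a => rfl, by simp⟩

theorem IsDualAutomorphism.unique {α β : CrossedProductZ₂ σ ≃⋆ₐ[ℂ] CrossedProductZ₂ σ}
    (hα : IsDualAutomorphism σ α) (hβ : IsDualAutomorphism σ β) : α = β := by
  have h : (α : CrossedProductZ₂ σ →⋆ₐ[ℂ] CrossedProductZ₂ σ) = β :=
    crossedProduct_hom_ext (fun a => (hα.1 a).trans (hβ.1 a).symm) (hα.2.trans hβ.2.symm)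
  ext1 x
  exact DFunLike.congr_fun h x

/-- The sign of `w` is absorbed into `z`. This gives both the end point condition and the passage
from a half circle to the full circle. -/
theorem IsDualAutomorphism.apply_crossedTwist
    {α : CrossedProductZ₂ σ ≃⋆ₐ[ℂ] CrossedProductZ₂ σ} (hα : IsDualAutomorphism σ α)
    {n : ℕ} (hn : 2 ∣ n) (z w : Circle) (hz : z ^ n = 1) (hw : w ^ n = 1) (hzw : (w : ℂ) = -z)
    (x : CyclicCrossedProduct σ n) :
    α (crossedTwist σ hn z hz x) = crossedTwist σ hn w hw x := by
  have h : (α : CrossedProductZ₂ σ →⋆ₐ[ℂ] CrossedProductZ₂ σ).comp (crossedTwist σ hn z hz) =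
      crossedTwist σ hn w hw := by
    refine crossedProduct_hom_ext (fun a => hα.1 a) ?_
    change α ((z : ℂ) • crossedUnitary σ 2) = (w : ℂ) • crossedUnitary σ 2
    rw [map_smul, hα.2, hzw, smul_neg, neg_smul]
  exact DFunLike.congr_fun h x

end CrossedHom

/-! ### Strongly continuous families of homomorphisms -/

section ContinuousFamily

/-- A `*`-homomorphism of C*-algebras as a continuous linear map. -/
noncomputable def StarAlgHom.toContinuousLinearMap {A B : Type*} [CStarAlgebra A] [CStarAlgebra B]
    (φ : A →⋆ₐ[ℂ] B) : A →L[ℂ] B :=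
  ⟨(φ : A →ₐ[ℂ] B).toLinearMap, map_continuous φ⟩

variable {X A B : Type*} [TopologicalSpace X] [CStarAlgebra A] [CStarAlgebra B]

/-- A strongly continuous family of `*`-homomorphisms, as one into continuous functions. -/
def starAlgHomToContinuousMap (χ : X → A →⋆ₐ[ℂ] B) (h : ∀ a, Continuous fun x => χ x a) :
    A →⋆ₐ[ℂ] C(X, B) where
  toFun a := ⟨fun x => χ x a, h a⟩
  map_one' := by ext x; simp
  map_mul' a b := by ext x; simp
  map_zero' := by ext x; simp
  map_add' a b := by ext x; simp
  commutes' c := by ext x; exact AlgHomClass.commutes (χ x) c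
  map_star' a := by ext x; exact map_star (χ x) a

/-- The elements with continuous orbit form a `*`-subalgebra, and homomorphisms are contractive, so
limits of such elements have uniformly approximated orbits. -/
theorem continuous_starAlgHom_family_of_dense {s : Set A}
    (hs : (StarAlgebra.adjoin ℂ s).topologicalClosure = ⊤) {χ : X → A →⋆ₐ[ℂ] B}
    (h : ∀ a ∈ s, Continuous fun x => χ x a) (a : A) : Continuous fun x => χ x a := by
  let D : StarSubalgebra ℂ A :=
    { carrier := {a | Continuous fun x => χ x a}
      mul_mem' := fun {a b} ha hb => by
        simpa only [Set.mem_ofPred_eq, map_mul] using! Continuous.mul ha hb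
      add_mem' := fun {a b} ha hb => by
        simpa only [Set.mem_ofPred_eq, map_add] using! Continuous.add ha hb
      algebraMap_mem' := fun c => by
        simpa only [Set.mem_ofPred_eq, AlgHomClass.commutes] using continuous_const
      star_mem' := fun {a} ha => by
        simpa only [Set.mem_ofPred_eq, map_star] using Continuous.star ha }
  have ha : a ∈ closure ((StarAlgebra.adjoin ℂ s : StarSubalgebra ℂ A) : Set A) := by
    rw [← StarSubalgebra.topologicalClosure_coe, hs]
    trivial
  refine continuous_of_uniform_approx_of_continuous fun u hu => ?_
  obtain ⟨ε, hε, hεu⟩ := Metric.mem_uniformity_dist.1 hu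
  obtain ⟨b, hb, hab⟩ := Metric.mem_closure_iff.1 ha ε hε
  refine ⟨fun x => χ x b, (StarAlgebra.adjoin_le h : _ ≤ D) hb, fun x => hεu ?_⟩
  rw [dist_eq_norm, ← map_sub]
  exact (NonUnitalStarAlgHom.norm_apply_le (χ x) _).trans_lt (by rwa [← dist_eq_norm])

end ContinuousFamily

/-! ### Monomials in a covariant pair -/

section Covariant

variable {O C : Type*} [CStarAlgebra O] [CStarAlgebra C] {σ : O ≃⋆ₐ[ℂ] O} {c : O →⋆ₐ[ℂ] C}
  {v : unitary C}

theorem unitary_zpow_mul_coeff (hcov : ∀ a, (v : C) * c a * star (v : C) = c (σ a)) (k : ℤ) :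
    ∀ a, ∃ b, ((v ^ k : unitary C) : C) * c a = c b * ((v ^ k : unitary C) : C) := by
  have h1 : ∀ a, (v : C) * c a = c (σ a) * v := fun a => by
    rw [← hcov, mul_assoc _ (star (v : C)), Unitary.coe_star_mul_self, mul_one]
  have h2 : ∀ a, ((v⁻¹ : unitary C) : C) * c a = c (σ.symm a) * ((v⁻¹ : unitary C) : C) := fun a => by
    have h := hcov (σ.symm a)
    rw [StarAlgEquiv.apply_symm_apply] at h
    change star (v : C) * c a = c (σ.symm a) * star (v : C)
    rw [← h, ← mul_assoc, ← mul_assoc, Unitary.coe_star_mul_self, one_mul]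
  induction k using Int.induction_on with
  | zero => exact fun a => ⟨a, by simp⟩
  | succ n ih =>
    intro a
    obtain ⟨b, hb⟩ := ih (σ a)
    exact ⟨b, by rw [zpow_add_one, Submonoid.coe_mul, mul_assoc, h1, ← mul_assoc, hb, mul_assoc]⟩
  | pred n ih =>
    intro a
    obtain ⟨b, hb⟩ := ih (σ.symm a)
    exact ⟨b, by rw [zpow_sub_one, Submonoid.coe_mul, mul_assoc, h2, ← mul_assoc, hb, mul_assoc]⟩

/-- By covariance the monomials `c a * v ^ k` are closed under products. They contain the generators
and their adjoints, so their span contains the generated `*`-algebra. -/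
theorem mem_closure_span_coeff_mul_zpow
    (hcov : ∀ a, (v : C) * c a * star (v : C) = c (σ a))
    (hdense : (StarAlgebra.adjoin ℂ (Set.range c ∪ {(v : C)})).topologicalClosure = ⊤) (x : C) :
    x ∈ closure (Submodule.span ℂ
      (Set.range fun p : O × ℤ => c p.1 * ((v ^ p.2 : unitary C) : C)) : Set C) := by
  let M : Submonoid C :=
    { carrier := Set.range fun p : O × ℤ => c p.1 * ((v ^ p.2 : unitary C) : C)
      one_mem' := ⟨(1, 0), by simp⟩
      mul_mem' := by
        rintro _ _ ⟨⟨a, k⟩, rfl⟩ ⟨⟨b, l⟩, rfl⟩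
        obtain ⟨d, hd⟩ := unitary_zpow_mul_coeff hcov k b
        refine ⟨(a * d, k + l), ?_⟩
        simp only [map_mul, zpow_add, Submonoid.coe_mul]
        rw [mul_assoc (c a) _ (c b * _), ← mul_assoc _ (c b), hd]
        simp only [mul_assoc] }
  have hx : x ∈ closure ((StarAlgebra.adjoin ℂ (Set.range c ∪ {(v : C)}) :
      StarSubalgebra ℂ C) : Set C) := by
    rw [← StarSubalgebra.topologicalClosure_coe, hdense]
    trivial
  refine closure_mono ?_ hx
  intro y hy
  have hM : Submonoid.closure ((Set.range c ∪ {(v : C)}) ∪ star (Set.range c ∪ {(v : C)})) ≤ M := by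
    refine Submonoid.closure_le.2 ?_
    have hc : ∀ a, c a ∈ M := fun a => ⟨(a, 0), by simp⟩
    rintro z ((⟨a, rfl⟩ | rfl) | (⟨a, ha⟩ | hz))
    · exact hc a
    · exact ⟨(1, 1), by simp⟩
    · rw [← star_star z, ← ha, ← map_star]
      exact hc _
    · refine ⟨(1, -1), ?_⟩
      rw [← star_star z, Set.mem_singleton_iff.1 hz]
      simp only [map_one, one_mul, zpow_neg_one]
      rfl
  have hy' : y ∈ Algebra.adjoin ℂ ((Set.range c ∪ {(v : C)}) ∪ star (Set.range c ∪ {(v : C)})) := hy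
  rw [← Subalgebra.mem_toSubmodule, Algebra.adjoin_eq_span] at hy'
  exact Submodule.span_mono hM hy'

end Covariant

/-! ### Vector-valued Fourier coefficients -/

section Fourier

open AddCircle MeasureTheory

variable {T : ℝ} [hT : Fact (0 < T)] {E : Type*} [NormedAddCommGroup E] [NormedSpace ℂ E]

variable (T E) in
/-- The `n`-th Fourier coefficient, as a continuous linear map. -/
noncomputable def fourierCoeffCLM (n : ℤ) : C(AddCircle T, E) →L[ℂ] E :=
  LinearMap.mkContinuous
    { toFun := fun f => fourierCoeff f n
      map_add' := fun f g => congrFun (fourierCoeff.add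
        ((map_continuous f).integrable_of_hasCompactSupport (.of_compactSpace f))
        ((map_continuous g).integrable_of_hasCompactSupport (.of_compactSpace g))) n
      map_smul' := fun a f => fourierCoeff.const_smul f a n } 1 fun f => by
    refine (norm_integral_le_of_norm_le_const (C := ‖f‖) (ae_of_all _ fun t => ?_)).trans ?_
    · rw [norm_smul, fourier_apply, Circle.norm_coe, one_mul]
      exact f.norm_coe_le_norm t
    · simp

theorem fourierCoeffCLM_apply (n : ℤ) (f : C(AddCircle T, E)) :
    fourierCoeffCLM T E n f = ∫ t, fourier (-n) t • f t ∂haarAddCircle := rfl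

theorem fourierCoeffCLM_fourier_smul [CompleteSpace E] (n k : ℤ) (x : E) (f : C(AddCircle T, E))
    (hf : ∀ t, f t = fourier k t • x) : fourierCoeffCLM T E n f = if k = n then x else 0 := by
  have h : fourierCoeffCLM T E n f = fourierCoeff (T := T) (fourier k) n • x := by
    rw [fourierCoeffCLM_apply, fourierCoeff, ← integral_smul_const]
    simp only [hf, smul_smul, smul_eq_mul]
  rw [h, fourierCoeff_fourier, Pi.single_apply]
  by_cases hkn : k = n <;> simp [hkn, eq_comm (a := n)]

theorem map_fourierCoeffCLM [CompleteSpace E] {F : Type*} [NormedAddCommGroup F] [NormedSpace ℂ F]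
    (L : E →L[ℂ] F) (n : ℤ) (f : C(AddCircle T, E)) [CompleteSpace F] :
    L (fourierCoeffCLM T E n f) = fourierCoeffCLM T F n ((L : C(E, F)).comp f) := by
  rw [fourierCoeffCLM_apply, fourierCoeffCLM_apply, ← L.integral_comp_comm]
  · simp only [map_smul]
    rfl
  · exact (((map_continuous f).integrable_of_hasCompactSupport
      (.of_compactSpace f))).fourier_smul _

/-- Continuous functionals reduce this to scalar functions, where a summable Fourier series
converges pointwise to its function. -/
theorem eq_zero_of_fourierCoeffCLM_eq_zero [CompleteSpace E] (f : C(AddCircle T, E))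
    (hf : ∀ n, fourierCoeffCLM T E n f = 0) : f = 0 := by
  ext t
  refine SeparatingDual.eq_zero_of_forall_dual_eq_zero (R := ℂ) fun L => ?_
  have h0 : fourierCoeff ((L : C(E, ℂ)).comp f) = 0 := by
    ext n
    exact (map_fourierCoeffCLM L n f).symm.trans (by rw [hf, map_zero]; rfl)
  have hs := has_pointwise_sum_fourier_series_of_summable
    (f := (L : C(E, ℂ)).comp f) (by rw [h0]; exact summable_zero) t
  simp only [h0, Pi.zero_apply, zero_smul] at hs
  exact hs.unique hasSum_zero

end Fourier

/-! ### Injectivity from the gauge action -/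

section Injectivity

open AddCircle

variable {T : ℝ} [hT : Fact (0 < T)] {O C B : Type*} [CStarAlgebra O] [CStarAlgebra C]
  [CStarAlgebra B] {σ : O ≃⋆ₐ[ℂ] O} {c : O →⋆ₐ[ℂ] C} {v : unitary C}

/-- The Fourier coefficients of the gauge action lie in the spectral subspaces. -/
theorem exists_fourierCoeff_gauge_eq
    (hcov : ∀ a, (v : C) * c a * star (v : C) = c (σ a))
    (hdense : (StarAlgebra.adjoin ℂ (Set.range c ∪ {(v : C)})).topologicalClosure = ⊤)
    (hc : Function.Injective c) (Γ : C →⋆ₐ[ℂ] C(AddCircle T, C))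
    (hΓc : ∀ a t, Γ (c a) t = c a) (hΓv : ∀ t, Γ v t = (fourier 1 t : ℂ) • (v : C)) (n : ℤ) (x : C) :
    ∃ a, fourierCoeffCLM T C n (Γ x) = c a * ((v ^ n : unitary C) : C) := by
  let l : O →ₗ[ℂ] C := (LinearMap.mulRight ℂ ((v ^ n : unitary C) : C)).comp
    (c : O →ₐ[ℂ] C).toLinearMap
  -- Being isometric, `l` has closed range, so the claim need only be checked on monomials; the
  -- orbit of `c a * v ^ k` is `fourier k` times it.
  have hl : Isometry l := AddMonoidHomClass.isometry_of_norm l fun a => by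
    change ‖c a * ((v ^ n : unitary C) : C)‖ = ‖a‖
    rw [CStarRing.norm_mul_coe_unitary, NonUnitalStarAlgHom.norm_map c hc]
  have hpow : ∀ (k : ℤ) t, Γ ((v ^ k : unitary C) : C) t =
      (fourier k t : ℂ) • ((v ^ k : unitary C) : C) := by
    have hinv : ∀ t, Γ ((v⁻¹ : unitary C) : C) t =
        (fourier (-1) t : ℂ) • ((v⁻¹ : unitary C) : C) := fun t => by
      change Γ (star (v : C)) t = (fourier (-1) t : ℂ) • star (v : C)
      rw [map_star, ContinuousMap.star_apply, hΓv, star_smul,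
        fourier_neg]
      rfl
    intro k t
    induction k using Int.induction_on with
    | zero => simp
    | succ m ih =>
      rw [zpow_add_one, Submonoid.coe_mul, map_mul, ContinuousMap.mul_apply, ih, hΓv,
        smul_mul_smul_comm, fourier_add]
    | pred m ih =>
      rw [zpow_sub_one, Submonoid.coe_mul, map_mul, ContinuousMap.mul_apply, ih, hinv,
        smul_mul_smul_comm, sub_eq_add_neg, fourier_add]
  let E : C →L[ℂ] C := (fourierCoeffCLM T C n).comp Γ.toContinuousLinearMap
  have hclosed : IsClosed ((LinearMap.range l).comap (E : C →ₗ[ℂ] C) : Set C) :=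
    hl.isClosedEmbedding.isClosed_range.preimage E.continuous
  have hle : Submodule.span ℂ (Set.range fun p : O × ℤ => c p.1 * ((v ^ p.2 : unitary C) : C)) ≤
      (LinearMap.range l).comap (E : C →ₗ[ℂ] C) := by
    refine Submodule.span_le.2 ?_
    rintro _ ⟨⟨a, k⟩, rfl⟩
    change fourierCoeffCLM T C n (Γ (c a * ((v ^ k : unitary C) : C))) ∈ LinearMap.range l
    rw [fourierCoeffCLM_fourier_smul n k (c a * ((v ^ k : unitary C) : C))]
    · split_ifs with hkn
      · exact ⟨a, by rw [hkn]; rfl⟩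
      · exact zero_mem _
    · intro t
      rw [map_mul, ContinuousMap.mul_apply, hΓc, hpow, mul_smul_comm]
  obtain ⟨a, ha⟩ := closure_minimal hle hclosed (mem_closure_span_coeff_mul_zpow hcov hdense x)
  exact ⟨a, ha.symm⟩

/-- `ψ` commutes with taking coefficients, so it kills each `c a * v ^ n`. Cancelling the unitary
leaves `ψ (c a) = 0`, hence `a = 0`. -/
theorem eq_zero_of_gauge_orbit_eq_zero
    (hcov : ∀ a, (v : C) * c a * star (v : C) = c (σ a))
    (hdense : (StarAlgebra.adjoin ℂ (Set.range c ∪ {(v : C)})).topologicalClosure = ⊤)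
    (Γ : C →⋆ₐ[ℂ] C(AddCircle T, C))
    (hΓc : ∀ a t, Γ (c a) t = c a) (hΓv : ∀ t, Γ v t = (fourier 1 t : ℂ) • (v : C))
    (ψ : C →⋆ₐ[ℂ] B) (hψ : Function.Injective (ψ.comp c)) {x : C}
    (hx : ∀ t, ψ (Γ x t) = 0) : Γ x = 0 := by
  refine eq_zero_of_fourierCoeffCLM_eq_zero _ fun n => ?_
  have hc : Function.Injective c := Function.Injective.of_comp (f := ψ) hψ
  obtain ⟨a, ha⟩ := exists_fourierCoeff_gauge_eq hcov hdense hc Γ hΓc hΓv n x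
  have h0 : ψ (fourierCoeffCLM T C n (Γ x)) = 0 := by
    refine (map_fourierCoeffCLM ψ.toContinuousLinearMap n (Γ x)).trans ?_
    have : (ψ.toContinuousLinearMap : C(C, B)).comp (Γ x) = 0 := by
      ext t
      exact hx t
    rw [this, map_zero]
  rw [ha] at h0 ⊢
  have h1 : ψ (c a) = 0 := by
    have := congrArg (· * ψ (star ((v ^ n : unitary C) : C))) h0
    simpa only [← map_mul, mul_assoc, Unitary.mul_star_self_of_mem (v ^ n).2, mul_one, zero_mul]
      using this
  have h2 : a = 0 := hψ (h1.trans (map_zero (ψ.comp c)).symm)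
  rw [h2, map_zero, zero_mul]

end Injectivity

/-! ### Stone–Weierstrass for twisted functions -/

section TwistedDensity

open Set

variable {B : Type*} [CStarAlgebra B] {α : B ≃⋆ₐ[ℂ] B}

instance fact_zero_lt_two_real : Fact ((0 : ℝ) < 2) := ⟨two_pos⟩

/-- The map gluing the end points of `[-1, 1]`. -/
def intervalToCircle : C(Icc (-1 : ℝ) 1, AddCircle (2 : ℝ)) :=
  ⟨fun t => ((t : ℝ) : AddCircle (2 : ℝ)), (AddCircle.continuous_mk' 2).comp continuous_subtype_val⟩

theorem intervalToCircle_surjective : Function.Surjective intervalToCircle := by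
  intro q
  have hq : q ∈ ((↑) : ℝ → AddCircle (2 : ℝ)) '' Icc (-1) (-1 + 2) := by
    rw [AddCircle.coe_image_Icc_eq]
    trivial
  obtain ⟨t, ht, rfl⟩ := hq
  exact ⟨⟨t, ht.1, ht.2.trans (by norm_num)⟩, rfl⟩

/-- Only the end points are glued, and `α` is isometric: the norm of a twisted function descends to
the circle. -/
theorem norm_apply_eq_of_mem_twistedFunctions {f : C(Icc (-1 : ℝ) 1, B)}
    (hf : f ∈ twistedFunctions α) {s t : Icc (-1 : ℝ) 1}
    (hst : intervalToCircle s = intervalToCircle t) : ‖f s‖ = ‖f t‖ := by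
  have hends : ‖f ⟨-1, by norm_num⟩‖ = ‖f ⟨1, by norm_num⟩‖ := by
    rw [show f ⟨-1, by norm_num⟩ = α (f ⟨1, by norm_num⟩) from hf, StarAlgEquiv.norm_map]
  obtain ⟨s, hs⟩ := s
  obtain ⟨t, ht⟩ := t
  have h0 : ((s - t : ℝ) : AddCircle (2 : ℝ)) = 0 := by
    rw [AddCircle.coe_sub, sub_eq_zero]
    exact hst
  obtain ⟨n, hn⟩ := (AddCircle.coe_eq_zero_iff (2 : ℝ)).1 h0
  rw [zsmul_eq_mul] at hn
  have h1 : n < 2 := by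
    have : (n : ℝ) < 2 := by linarith [hs.2, ht.1]
    exact_mod_cast this
  have h2 : -2 < n := by
    have : (-2 : ℝ) < n := by linarith [hs.1, ht.2]
    exact_mod_cast this
  obtain rfl | rfl | rfl : n = -1 ∨ n = 0 ∨ n = 1 := by omega
  · obtain rfl : s = -1 := by push_cast at hn; linarith [hs.1, ht.2]
    obtain rfl : t = 1 := by push_cast at hn; linarith
    exact hends
  · obtain rfl : s = t := by push_cast at hn; linarith
    rfl
  · obtain rfl : s = 1 := by push_cast at hn; linarith [hs.2, ht.1]
    obtain rfl : t = -1 := by push_cast at hn; linarith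
    exact hends.symm

variable (B) in
/-- Scalar functions on the circle, as `B`-valued functions on `[-1, 1]`. -/
noncomputable def circleScalar : C(AddCircle (2 : ℝ), ℂ) →⋆ₐ[ℂ] C(Icc (-1 : ℝ) 1, B) where
  toFun g := ⟨fun t => algebraMap ℂ B (g (intervalToCircle t)),
    (continuous_algebraMap ℂ B).comp (g.continuous.comp intervalToCircle.continuous)⟩
  map_one' := by ext t; simp
  map_mul' f g := by ext t; simp
  map_zero' := by ext t; simp
  map_add' f g := by ext t; simp
  commutes' c := by ext t; rfl
  map_star' g := by ext t; exact algebraMap_star_comm _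

theorem circleScalar_apply (g : C(AddCircle (2 : ℝ), ℂ)) (t : Icc (-1 : ℝ) 1) :
    circleScalar B g t = algebraMap ℂ B (g (intervalToCircle t)) := rfl

/-- `fourier 1` and its adjoint generate all characters, whose span is dense. -/
theorem circleScalar_mem {R : StarSubalgebra ℂ C(Icc (-1 : ℝ) 1, B)}
    (hR : IsClosed (R : Set C(Icc (-1 : ℝ) 1, B))) (h1 : circleScalar B (fourier 1) ∈ R)
    (g : C(AddCircle (2 : ℝ), ℂ)) : circleScalar B g ∈ R := by
  have hneg : circleScalar B (fourier (-1)) ∈ R := by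
    have : (fourier (-1) : C(AddCircle (2 : ℝ), ℂ)) = star (fourier 1) := by
      ext t
      exact fourier_neg
    rw [this, map_star]
    exact star_mem h1
  have hk : ∀ k, circleScalar B (fourier k) ∈ R := by
    have hadd : ∀ m n, (fourier (m + n) : C(AddCircle (2 : ℝ), ℂ)) = fourier m * fourier n :=
      fun m n => by ext t; exact fourier_add
    intro k
    induction k using Int.induction_on with
    | zero =>
      have : (fourier 0 : C(AddCircle (2 : ℝ), ℂ)) = 1 := by ext t; exact fourier_zero
      rw [this, map_one]
      exact one_mem R
    | succ m ih =>
      rw [hadd, map_mul]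
      exact mul_mem ih h1
    | pred m ih =>
      rw [sub_eq_add_neg, hadd, map_mul]
      exact mul_mem ih hneg
  let P : Submodule ℂ C(AddCircle (2 : ℝ), ℂ) :=
    (Subalgebra.toSubmodule R.toSubalgebra).comap (circleScalar B).toAlgHom.toLinearMap
  have hP : IsClosed (P : Set C(AddCircle (2 : ℝ), ℂ)) :=
    hR.preimage (map_continuous (circleScalar B))
  have hle : (Submodule.span ℂ (range (@fourier 2))).topologicalClosure ≤ P := by
    refine Submodule.topologicalClosure_minimal _ (Submodule.span_le.2 ?_) hP
    rintro _ ⟨k, rfl⟩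
    exact hk k
  rw [span_fourier_closure_eq_top] at hle
  exact hle (Submodule.mem_top : g ∈ ⊤)

/-- A vector-valued Stone–Weierstrass theorem for twisted functions. -/
theorem twistedFunctions_le_of_dense {R : StarSubalgebra ℂ C(Icc (-1 : ℝ) 1, B)}
    (hR : IsClosed (R : Set C(Icc (-1 : ℝ) 1, B))) (hle : R ≤ twistedFunctions α)
    (h1 : circleScalar B (fourier 1) ∈ R)
    (hdense : ∀ t b, ∀ ε > 0, ∃ r ∈ R, ‖r t - b‖ < ε) : twistedFunctions α ≤ R := by
  intro f hf
  rw [← SetLike.mem_coe, ← hR.closure_eq, Metric.mem_closure_iff]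
  intro ε hε
  choose r hrR hr using fun t => hdense t (f t) (ε / 2) (half_pos hε)
  -- The circle points over which `r t` is everywhere within `ε / 2` of `f`. The partition of unity
  -- must live on the circle for its functions to lie in `R`.
  let U : Icc (-1 : ℝ) 1 → Set (AddCircle (2 : ℝ)) := fun t =>
    (intervalToCircle '' {s | ε / 2 ≤ ‖(r t - f) s‖})ᶜ
  have hUo : ∀ t, IsOpen (U t) := fun t => by
    refine IsClosed.isOpen_compl (self := IsCompact.isClosed (IsCompact.image ?_ (map_continuous _)))
    exact (isClosed_le continuous_const (map_continuous (r t - f)).norm).isCompact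
  have hU : univ ⊆ ⋃ t, U t := by
    intro q _
    obtain ⟨t, rfl⟩ := intervalToCircle_surjective q
    refine mem_iUnion.2 ⟨t, ?_⟩
    rintro ⟨s, hs, hst⟩
    rw [mem_ofPred_eq, norm_apply_eq_of_mem_twistedFunctions (sub_mem (hle (hrR t)) hf) hst] at hs
    exact absurd (hr t) (not_lt.2 hs)
  obtain ⟨F, hF⟩ := isCompact_univ.elim_finite_subcover U hUo hU
  obtain ⟨ρ, hρ⟩ := PartitionOfUnity.exists_isSubordinate isClosed_univ (fun i : F => U i)
    (fun i => hUo i) (fun q hq => by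
      obtain ⟨i, hi, hqi⟩ := mem_iUnion₂.1 (hF hq)
      exact mem_iUnion.2 ⟨⟨i, hi⟩, hqi⟩)
  let ρc : F → C(AddCircle (2 : ℝ), ℂ) := fun i => ⟨fun q => (ρ i q : ℂ),
    Complex.continuous_ofReal.comp (ρ i).continuous⟩
  refine ⟨∑ i, circleScalar B (ρc i) * r i, sum_mem fun i _ =>
    mul_mem (circleScalar_mem hR h1 _) (hrR i), ?_⟩
  refine lt_of_le_of_lt ?_ (half_lt_self hε)
  rw [ContinuousMap.dist_le (half_pos hε).le]
  intro t
  -- The value at `t` is a convex combination of those `r i t` that lie in the ball around `f t`.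
  have hmem := ρ.finsum_smul_mem_convex (g := fun i _ => r i t)
    (t := Metric.ball (f t) (ε / 2)) (mem_univ (intervalToCircle t)) (fun i hi => ?_)
    (convex_ball _ _)
  · rw [finsum_eq_sum_of_fintype, Metric.mem_ball, dist_comm] at hmem
    refine le_trans (le_of_eq ?_) hmem.le
    congr 1
    rw [ContinuousMap.sum_apply]
    refine Finset.sum_congr rfl fun i _ => ?_
    rw [ContinuousMap.mul_apply, circleScalar_apply, ← Algebra.smul_def]
    rfl
  · have hi' : intervalToCircle t ∈ U i := hρ i (subset_tsupport _ hi)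
    rw [Metric.mem_ball, dist_eq_norm]
    by_contra hcon
    exact hi' ⟨t, not_lt.1 hcon, rfl⟩

end TwistedDensity

theorem StarAlgHom.map_complex_smul {A B : Type*} [CStarAlgebra A] [CStarAlgebra B]
    (φ : A →⋆ₐ[ℂ] B) (c : ℂ) (x : A) : φ (c • x) = c • φ x :=
  map_smul φ c x

theorem nonempty_starAlgEquiv_of_injective {A B : Type*} [CStarAlgebra A] [CStarAlgebra B]
    (φ : A →⋆ₐ[ℂ] B) (hφ : Function.Injective φ) (S : StarSubalgebra ℂ B) (hS : ∀ a, φ a ∈ S)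
    (hsurj : ∀ b ∈ S, ∃ a, φ a = b) : Nonempty (A ≃⋆ₐ[ℂ] S) :=
  ⟨StarAlgEquiv.ofBijective (φ.codRestrict S hS)
    ⟨(StarAlgHom.injective_codRestrict φ S hS).2 hφ, fun ⟨b, hb⟩ =>
      (hsurj b hb).imp fun _ ha => Subtype.ext ha⟩⟩

/-! ### The mapping torus isomorphism -/

section MappingTorus

open Set

universe u

variable {O : Type u} [CStarAlgebra O] {σ : O ≃⋆ₐ[ℂ] O}

theorem continuous_crossedTwist {X : Type*} [TopologicalSpace X] {m : ℕ} {z : X → Circle}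
    (hz : Continuous z) (x : CyclicCrossedProduct σ 0) :
    Continuous fun t => crossedTwist σ (dvd_zero m) (z t) (pow_zero _) x := by
  refine continuous_starAlgHom_family_of_dense (crossedProduct_dense σ 0) ?_ x
  rintro _ (⟨a, rfl⟩ | rfl)
  · exact (continuous_const : Continuous fun _ : X => crossedCoeff σ m a)
  · exact (Continuous.comp continuous_subtype_val hz).smul
      (continuous_const : Continuous fun _ : X => crossedUnitary σ m)

/-- The path `t ↦ exp(iπt/2)` from `-i` to `i`. -/
noncomputable def halfTurn (t : Icc (-1 : ℝ) 1) : Circle := Circle.exp (Real.pi * t / 2)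

theorem continuous_halfTurn : Continuous halfTurn := by
  exact Circle.exp.continuous.comp ((continuous_const.mul continuous_subtype_val).div_const 2)

theorem halfTurn_neg_one :
    (halfTurn ⟨-1, by norm_num⟩ : ℂ) = -(halfTurn ⟨1, by norm_num⟩ : ℂ) := by
  rw [halfTurn, halfTurn, Circle.coe_exp, Circle.coe_exp, ← Complex.exp_antiperiodic.sub_eq]
  congr 1
  push_cast
  ring

theorem exists_halfTurn_eq (z : Circle) : ∃ t, halfTurn t = z ∨ halfTurn t = -z := by
  have key : ∀ w : Circle, 0 ≤ (w : ℂ).re → ∃ t, halfTurn t = w := by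
    intro w hw
    have h := abs_le.1 (Complex.abs_arg_le_pi_div_two_iff.2 hw)
    have hpi := Real.pi_pos
    refine ⟨⟨2 * Complex.arg w / Real.pi, ?_, ?_⟩, ?_⟩
    · rw [le_div_iff₀ hpi]
      linarith
    · rw [div_le_iff₀ hpi]
      linarith
    · rw [halfTurn, show Real.pi * (2 * Complex.arg w / Real.pi) / 2 = Complex.arg w by
        field_simp]
      exact Circle.exp_arg w
  rcases le_total 0 (z : ℂ).re with h | h
  · exact (key z h).imp fun t ht => Or.inl ht
  · exact (key (-z) (by simpa using! h)).imp fun t ht => Or.inr ht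

variable (σ) in
/-- The `*`-homomorphism `O ⋊ ℤ → C([-1, 1], O ⋊ ℤ₂)`, sending the unitary `U` to
`t ↦ exp(iπt/2) w`. -/
noncomputable def mappingTorusHom :
    CrossedProductZ σ →⋆ₐ[ℂ] C(Icc (-1 : ℝ) 1, CrossedProductZ₂ σ) :=
  starAlgHomToContinuousMap (fun t => crossedTwist σ (dvd_zero 2) (halfTurn t) (pow_zero _))
    (continuous_crossedTwist continuous_halfTurn)

theorem mappingTorusHom_apply (x : CrossedProductZ σ) (t : Icc (-1 : ℝ) 1) :
    mappingTorusHom σ x t = crossedTwist σ (dvd_zero 2) (halfTurn t) (pow_zero _) x := rfl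

variable (σ) in
/-- The gauge action on `O ⋊ ℤ`. -/
noncomputable def gaugeHom :
    CrossedProductZ σ →⋆ₐ[ℂ] C(AddCircle (2 : ℝ), CrossedProductZ σ) :=
  starAlgHomToContinuousMap
    (fun t => crossedTwist σ (dvd_zero 0) (AddCircle.toCircle t) (pow_zero _))
    (continuous_crossedTwist AddCircle.continuous_toCircle)

theorem gaugeHom_apply (x : CrossedProductZ σ) (t : AddCircle (2 : ℝ)) :
    gaugeHom σ x t = crossedTwist σ (dvd_zero 0) (AddCircle.toCircle t) (pow_zero _) x := rfl

/-- Scalars multiply under composition: the canonical map `U ↦ w` along the gauge orbit runs through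
all twists. -/
theorem crossedTwist_one_gaugeHom (x : CrossedProductZ σ) (m : ℕ) (t : AddCircle (2 : ℝ)) :
    crossedTwist σ (dvd_zero m) 1 (pow_zero _) (gaugeHom σ x t) =
      crossedTwist σ (dvd_zero m) (AddCircle.toCircle t) (pow_zero _) x := by
  have h : (crossedTwist σ (dvd_zero m) 1 (pow_zero _)).comp
      (crossedTwist σ (dvd_zero 0) (AddCircle.toCircle t) (pow_zero _)) =
      crossedTwist σ (dvd_zero m) (AddCircle.toCircle t) (pow_zero _) := by
    refine crossedProduct_hom_ext (fun a => ?_) ?_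
    · rw [StarAlgHom.comp_apply, crossedTwist_crossedCoeff, crossedTwist_crossedCoeff,
        crossedTwist_crossedCoeff]
    · rw [StarAlgHom.comp_apply, crossedTwist_crossedUnitary, StarAlgHom.map_complex_smul,
        crossedTwist_crossedUnitary, crossedTwist_crossedUnitary, Circle.coe_one, one_smul]
  rw [← h, StarAlgHom.comp_apply, gaugeHom_apply]

theorem gaugeHom_zero (x : CrossedProductZ σ) : gaugeHom σ x 0 = x := by
  have h : crossedTwist σ (dvd_zero 0) (AddCircle.toCircle (0 : AddCircle (2 : ℝ))) (pow_zero _) =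
      StarAlgHom.id ℂ (CyclicCrossedProduct σ 0) := by
    refine crossedProduct_hom_ext (fun a => ?_) ?_
    · rw [crossedTwist_crossedCoeff]
      rfl
    · rw [crossedTwist_crossedUnitary, AddCircle.toCircle_zero, Circle.coe_one, one_smul]
      rfl
  rw [gaugeHom_apply, h]
  rfl

variable {α : CrossedProductZ₂ σ ≃⋆ₐ[ℂ] CrossedProductZ₂ σ}

theorem mappingTorusHom_mem (hα : IsDualAutomorphism σ α) (x : CrossedProductZ σ) :
    mappingTorusHom σ x ∈ twistedFunctions α :=
  (hα.apply_crossedTwist (dvd_zero 2) _ _ (pow_zero _) (pow_zero _) halfTurn_neg_one x).symm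

theorem mappingTorusHom_injective (h : ∀ a, σ (σ a) = a) :
    Function.Injective (mappingTorusHom σ) := by
  obtain ⟨α, hα⟩ := exists_isDualAutomorphism (σ := σ)
  rw [injective_iff_map_eq_zero]
  intro x hx
  have hz : ∀ z : Circle, crossedTwist σ (dvd_zero 2) z (pow_zero _) x = 0 := by
    intro z
    obtain ⟨t, rfl | ht⟩ := exists_halfTurn_eq z
    · exact DFunLike.congr_fun hx t
    -- Here `-z` is on the half circle, and `α` carries the twist by `-z` to that by `z`.
    · rw [← hα.apply_crossedTwist (dvd_zero 2) (-z) z (pow_zero _) (pow_zero _) (by simp) x]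
      have h0 : crossedTwist σ (dvd_zero 2) (halfTurn t) (pow_zero _) x = 0 :=
        DFunLike.congr_fun hx t
      simp only [ht] at h0
      rw [h0, map_zero]
  have hΓ : gaugeHom σ x = 0 := by
    refine eq_zero_of_gauge_orbit_eq_zero (σ := σ) (c := crossedCoeffHom σ 0)
      (v := ⟨crossedUnitary σ 0, crossedUnitary_mem_unitary 0⟩) (crossedUnitary_covariant 0)
      (crossedProduct_dense σ 0) (gaugeHom σ) (fun a t => rfl) (fun t => ?_)
      (crossedTwist σ (dvd_zero 2) 1 (pow_zero _)) (crossedCoeffHom_two_injective h) fun t => ?_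
    · rw [fourier_one]
      rfl
    · rw [crossedTwist_one_gaugeHom, hz]
  rw [← gaugeHom_zero x, hΓ]
  rfl

/-- Evaluation at `t` hits the generators: `w` is the image of `z⁻¹ U` with `z = halfTurn t`. -/
theorem exists_mappingTorusHom_apply_near (t : Icc (-1 : ℝ) 1) (b : CrossedProductZ₂ σ) {ε : ℝ}
    (hε : 0 < ε) : ∃ x, ‖mappingTorusHom σ x t - b‖ < ε := by
  have hle : StarAlgebra.adjoin ℂ (range (crossedCoeffHom σ 2) ∪ {crossedUnitary σ 2}) ≤
      (crossedTwist σ (dvd_zero 2) (halfTurn t) (pow_zero _)).range := by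
    refine StarAlgebra.adjoin_le ?_
    rintro _ (⟨a, rfl⟩ | rfl)
    · exact ⟨crossedCoeff σ 0 a, rfl⟩
    · refine ⟨(((halfTurn t)⁻¹ : Circle) : ℂ) • crossedUnitary σ 0, ?_⟩
      refine (StarAlgHom.map_complex_smul (crossedTwist σ (dvd_zero 2) (halfTurn t) (pow_zero _))
        (((halfTurn t)⁻¹ : Circle) : ℂ) (crossedUnitary σ 0)).trans ?_
      rw [crossedTwist_crossedUnitary, smul_smul, ← Circle.coe_mul, inv_mul_cancel, Circle.coe_one,
        one_smul]
  have hb : b ∈ closure ((StarAlgebra.adjoin ℂ (range (crossedCoeffHom σ 2) ∪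
      {crossedUnitary σ 2}) : StarSubalgebra ℂ (CyclicCrossedProduct σ 2)) :
        Set (CyclicCrossedProduct σ 2)) := by
    rw [← StarSubalgebra.topologicalClosure_coe, crossedProduct_dense]
    trivial
  obtain ⟨y, hy, hby⟩ := Metric.mem_closure_iff.1 hb ε hε
  obtain ⟨x, hx⟩ := hle hy
  refine ⟨x, ?_⟩
  rw [← dist_eq_norm, dist_comm]
  exact (congrArg (dist b) hx).trans_lt hby

theorem crossedUnitary_two_pow_two : crossedUnitary σ 2 ^ 2 = 1 := by
  apply Subtype.ext
  ext ρ
  exact ρ.pow_eq_one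

/-- As `w² = 1`, squaring leaves the scalar `exp(iπt)`, the basic character of the circle of length
`2`. -/
theorem mappingTorusHom_crossedUnitary_sq :
    mappingTorusHom σ (crossedUnitary σ 0 ^ 2) = circleScalar _ (fourier 1) := by
  ext1 t
  rw [mappingTorusHom_apply, map_pow, crossedTwist_crossedUnitary, smul_pow,
    crossedUnitary_two_pow_two, circleScalar_apply, Algebra.algebraMap_eq_smul_one, fourier_one]
  congr 1
  have ht : intervalToCircle t = ((t : ℝ) : AddCircle (2 : ℝ)) := rfl
  rw [← Circle.coe_pow, halfTurn, ← Circle.exp_nsmul, ht, AddCircle.toCircle_apply_mk]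
  congr 2
  simp only [nsmul_eq_mul]
  push_cast
  ring

theorem mappingTorusHom_surjective (hα : IsDualAutomorphism σ α) (h : ∀ a, σ (σ a) = a)
    {f : C(Icc (-1 : ℝ) 1, CrossedProductZ₂ σ)} (hf : f ∈ twistedFunctions α) :
    ∃ x, mappingTorusHom σ x = f := by
  refine twistedFunctions_le_of_dense (R := (mappingTorusHom σ).range) (α := α) ?_ ?_ ?_ ?_ hf
  -- An injective `*`-homomorphism of C*-algebras is isometric, so its range is closed.
  · exact (NonUnitalStarAlgHom.isometry _
      (mappingTorusHom_injective h)).isClosedEmbedding.isClosed_range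
  · rintro _ ⟨x, rfl⟩
    exact mappingTorusHom_mem hα x
  · exact ⟨_, mappingTorusHom_crossedUnitary_sq⟩
  · intro t b ε hε
    obtain ⟨x, hx⟩ := exists_mappingTorusHom_apply_near t b hε
    exact ⟨_, ⟨x, rfl⟩, hx⟩

/-- `O ⋊ ℤ` is the mapping torus of the dual automorphism of `O ⋊ ℤ₂`. -/
theorem nonempty_crossedProductZ_equiv (hα : IsDualAutomorphism σ α) (h : ∀ a, σ (σ a) = a) :
    Nonempty (CrossedProductZ σ ≃⋆ₐ[ℂ] twistedFunctions α) := by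
  exact nonempty_starAlgEquiv_of_injective (mappingTorusHom σ) (mappingTorusHom_injective h) _
    (mappingTorusHom_mem hα) fun f hf => mappingTorusHom_surjective hα h hf

theorem dualAutomorphism_and_mappingTorus (h : ∀ a, σ (σ a) = a) :
    (∃! σhat : CrossedProductZ₂ σ ≃⋆ₐ[ℂ] CrossedProductZ₂ σ, IsDualAutomorphism σ σhat) ∧
      ∀ σhat : CrossedProductZ₂ σ ≃⋆ₐ[ℂ] CrossedProductZ₂ σ, IsDualAutomorphism σ σhat →
        Nonempty (CrossedProductZ σ ≃⋆ₐ[ℂ] twistedFunctions σhat) := by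
  obtain ⟨α, hα⟩ := exists_isDualAutomorphism (σ := σ)
  exact ⟨⟨α, hα, fun β hβ => hβ.unique hα⟩, fun β hβ => nonempty_crossedProductZ_equiv hβ h⟩

end MappingTorus

theorem IsSwap.dualAutomorphism_and_mappingTorus {A : Type*} [CStarAlgebra A] {S₁ S₂ : A}
    {σ : cstarGenerated {S₁, S₂} ≃⋆ₐ[ℂ] cstarGenerated {S₁, S₂}} (hσ : IsSwap S₁ S₂ σ) :
    (∃! σhat : CrossedProductZ₂ σ ≃⋆ₐ[ℂ] CrossedProductZ₂ σ, IsDualAutomorphism σ σhat) ∧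
      ∀ σhat : CrossedProductZ₂ σ ≃⋆ₐ[ℂ] CrossedProductZ₂ σ, IsDualAutomorphism σ σhat →
        Nonempty (CrossedProductZ σ ≃⋆ₐ[ℂ] twistedFunctions σhat) :=
  _root_.dualAutomorphism_and_mappingTorus hσ.apply_apply

theorem existsUnique_isSwap_cuntzO₂ :
    ∃! σ : CuntzO₂ ≃⋆ₐ[ℂ] CuntzO₂, IsSwap univS₁ univS₂ σ :=
  exists_isSwap_cuntzO₂.imp fun _ hσ => ⟨hσ, fun _ hτ => hτ.unique hσ⟩

theorem mainTheorem6 :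
    -- the Cuntz algebra, with the automorphism exchanging its canonical generators
    ((∃! σ : CuntzO₂ ≃⋆ₐ[ℂ] CuntzO₂, IsSwap univS₁ univS₂ σ) ∧
      ∀ σ : CuntzO₂ ≃⋆ₐ[ℂ] CuntzO₂, IsSwap univS₁ univS₂ σ →
        (∃! σhat : CrossedProductZ₂ σ ≃⋆ₐ[ℂ] CrossedProductZ₂ σ, IsDualAutomorphism σ σhat) ∧
        ∀ σhat : CrossedProductZ₂ σ ≃⋆ₐ[ℂ] CrossedProductZ₂ σ, IsDualAutomorphism σ σhat →
          Nonempty (CrossedProductZ σ ≃⋆ₐ[ℂ] twistedFunctions σhat)) ∧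
    -- the same for the C*-algebra generated by an arbitrary Cuntz pair
    ∀ (A : Type*) [CStarAlgebra A] (S₁ S₂ : A), IsCuntzPair S₁ S₂ →
      ∀ σ : cstarGenerated {S₁, S₂} ≃⋆ₐ[ℂ] cstarGenerated {S₁, S₂}, IsSwap S₁ S₂ σ →
        (∃! σhat : CrossedProductZ₂ σ ≃⋆ₐ[ℂ] CrossedProductZ₂ σ, IsDualAutomorphism σ σhat) ∧
        ∀ σhat : CrossedProductZ₂ σ ≃⋆ₐ[ℂ] CrossedProductZ₂ σ, IsDualAutomorphism σ σhat →
          Nonempty (CrossedProductZ σ ≃⋆ₐ[ℂ] twistedFunctions σhat) := by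
  refine ⟨⟨existsUnique_isSwap_cuntzO₂, fun σ hσ => ?_⟩, fun A _ S₁ S₂ _ σ hσ => ?_⟩
  · exact IsSwap.dualAutomorphism_and_mappingTorus hσ
  · exact hσ.dualAutomorphism_and_mappingTorus
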